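/- Write $(x,y)$ with $x,y\in\{0,1\}^{\mathbb Z}$ for a microstate of the Kac infinite chain ($2x(i)-1$ is the spin and $y(i)$ the scatterer occupation at site $i$). The dynamics $\varphi$ on $\{0,1\}^{\mathbb Z}\times\{0,1\}^{\mathbb Z}$ is \[\varphi(x,y)(i)=\bigl(x(i-1)+y(i-1)-2x(i-1)y(i-1),\ y(i)\bigr),\] the macroscopic variables are \[m_0^N(x,y)=\frac1{2N+1}\sum_{i=-N}^{N}(2x(i)-1),\qquad m_1^N(x,y)=\frac1{2N+1}\sum_{i=-N}^{N}y(i),\] and the macroscopic law is $\Phi(m_0,m_1)=((1-2m_1)m_0,\,m_1)$. For $p\in[0,1]$ let $\mu_p$ be the Bernoulli measure on $\{0,1\}^{\mathbb Z}$ (independent sites, each equal to $1$ with probability $p$), and put $\mu_m=\mu_{(1+m_0)/2}\times\mu_{m_1}$. A real $r$ is computable if $\{q\in\mathbb Q:q<r\}$ and $\{q\in\mathbb Q:q<-r\}$ are computably enumerable. A Martin-Löf test for a computable probability measure $\nu$ on $\{0,1\}^{\mathbb N}$ is a sequence $U_n=\bigcup_{\sigma\in S_n}[\sigma]$, where $[\sigma]$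 is the set of infinite sequences with prefix $\sigma$ and $(S_n)_{n\in\mathbb N}$ is a sequence of sets of finite binary strings that is computably enumerable uniformly in $n$, such that $\nu(U_n)\le 2^{-n}$ for all $n\in\mathbb N$; $z\in\{0,1\}^{\mathbb N}$ is Martin-Löf random with respect to $\nu$ if $z\notin\bigcap_n U_n$ for every such test. A microstate $(x,y)$ is Martin-Löf random with respect to $\mu_m$ if its code $\kappa(\iota(x),\iota(y))$ is Martin-Löf random with respect to the image of $\mu_m$ under $(x,y)\mapsto\kappa(\iota(x),\iota(y))$, where $\iota(x)=x(0)x(-1)x(1)x(-2)x(2)\dots$ and $\kappa(u,v)=u(0)v(0)u(1)v(1)\dots$. Theorem. Let $m=(m_0,m_1)\in[-1,1]\times[0,1]$ with $m_0$ and $m_1$ computable reals, and let $T\in\mathbb N$. If $(x,y)\in\{0,1\}^{\mathbb Z}\times\{0,1\}^{\mathbb Z}$ is Martin-Löf random with respect to $\mu_m$, then \[\lim_{N\to\infty}m_i^N(\varphi^t(x,y))=\Phi_i^t(m)\qquad\text{for all } i\in\{0,1\}\text{ and } t\in\{0,\dots,T\},\] where $\Phi_i^t(m)$ is the $i$-th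 component of $\Phi^t(m)$. -/

import Mathlib

open MeasureTheory ProbabilityTheory Filter Topology
open scoped ENNReal

noncomputable section

namespace KacChain

/-! ### Computability -/

/-- A set `A` of finite objects is computably enumerable if it is the range of a partial
computable function defined on (a subset of) the finite binary strings. -/
def IsCE {α : Type} [Primcodable α] (A : Set α) : Prop :=
  ∃ f : List Bool →. α, Partrec f ∧ A = {a | ∃ σ, a ∈ f σ}

/-- A sequence of sets of finite binary strings is computably enumerable uniformly in `n`. -/
def UniformlyCE (A : ℕ → Set (List Bool)) : Prop :=
  ∃ f : List Bool × ℕ →. List Bool, Partrec f ∧ ∀ n, A n = {τ | ∃ σ, τ ∈ f (σ, n)}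

/-- The rational number `(-1)^δ * p / (q + 1)` coded by `(δ, p, q)`. Every rational has such
a code. -/
def ratOfCode (c : Bool × ℕ × ℕ) : ℚ :=
  (if c.1 then -1 else 1) * (c.2.1 : ℚ) / ((c.2.2 : ℚ) + 1)

/-- The set of rationals below `x` is computably enumerable. -/
def LowerSemicomputable (x : ℝ) : Prop :=
  IsCE {c : Bool × ℕ × ℕ | (ratOfCode c : ℝ) < x}

/-- `x` is a computable real: both `x` and `-x` are lower semicomputable. -/
def IsComputableReal (x : ℝ) : Prop :=
  LowerSemicomputable x ∧ LowerSemicomputable (-x)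

/-! ### Martin-Löf randomness on the Cantor space -/

/-- The cylinder set `[σ]` of all infinite binary sequences with prefix `σ`. -/
def cylinder (σ : List Bool) : Set (ℕ → Bool) :=
  {x | ∀ i, ∀ h : i < σ.length, x i = σ[i]}

/-- The sequence `U` of subsets of the Cantor space is c.e. open uniformly in `n`. -/
def UniformlyCEOpen (U : ℕ → Set (ℕ → Bool)) : Prop :=
  ∃ S : ℕ → Set (List Bool), UniformlyCE S ∧ ∀ n, U n = ⋃ σ ∈ S n, cylinder σ

/-- Martin-Löf tests with respect to `μ`. -/
def IsMLTest (μ : Measure (ℕ → Bool)) (U : ℕ → Set (ℕ → Bool)) : Prop :=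
  UniformlyCEOpen U ∧ ∀ n, μ (U n) ≤ (2 : ℝ≥0∞)⁻¹ ^ n

/-- Martin-Löf null sets with respect to `μ`. -/
def IsMLNull (μ : Measure (ℕ → Bool)) (A : Set (ℕ → Bool)) : Prop :=
  ∃ U, IsMLTest μ U ∧ A ⊆ ⋂ n, U n

/-- `x` is Martin-Löf random with respect to `μ`. -/
def IsMLRandom (μ : Measure (ℕ → Bool)) (x : ℕ → Bool) : Prop :=
  ¬ IsMLNull μ {x}

/-! ### Microstates and their coding -/

/-- Microstates `(x, y)`, with `x, y : ℤ → {0, 1}`; `true` stands for `1`, `false` for `0`. -/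
abbrev State : Type := (ℤ → Bool) × (ℤ → Bool)

/-- The enumeration `0, -1, 1, -2, 2, …` of the integers. -/
def site (n : ℕ) : ℤ :=
  if n % 2 = 0 then ((n / 2 : ℕ) : ℤ) else -(((n + 1) / 2 : ℕ) : ℤ)

/-- `iota x = x(0) x(-1) x(1) x(-2) x(2) …`. -/
def iota (x : ℤ → Bool) : ℕ → Bool := fun n => x (site n)

/-- `kappa x y = x(0) y(0) x(1) y(1) …`. -/
def kappa (x y : ℕ → Bool) : ℕ → Bool :=
  fun n => if n % 2 = 0 then x (n / 2) else y (n / 2)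

/-- The coding of microstates by one-sided infinite binary sequences. -/
def encode (s : State) : ℕ → Bool := kappa (iota s.1) (iota s.2)

theorem measurable_encode : Measurable encode := by
  refine measurable_pi_lambda _ fun n => ?_
  unfold encode kappa iota
  split_ifs
  · exact (measurable_pi_apply _).comp measurable_fst
  · exact (measurable_pi_apply _).comp measurable_snd

/-- Martin-Löf randomness of a microstate with respect to a measure on the space of
microstates: its code is random with respect to the image measure. -/
def IsMLRandomState (μ : Measure State) (s : State) : Prop :=
  IsMLRandom (μ.map encode) (encode s)

/-! ### The initial measure -/

/-- The Bernoulli measure on `{0, 1}^ℤ` with parameter `p ∈ [0, 1]`: the product over all sites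
of the measure giving mass `p` to `1` and `1 - p` to `0`. -/
def siteBernoulli (p : unitInterval) : Measure (ℤ → Bool) :=
  Measure.infinitePi fun _ : ℤ => bernoulliMeasure true false p

/-- The space `[-1, 1] × [0, 1]` of macroscopic states `m = (m 0, m 1)`. -/
def IsMacrostate (m : Fin 2 → ℝ) : Prop :=
  m 0 ∈ Set.Icc (-1 : ℝ) 1 ∧ m 1 ∈ Set.Icc (0 : ℝ) 1

theorem IsMacrostate.up_mem {m : Fin 2 → ℝ} (h : IsMacrostate m) :
    (1 + m 0) / 2 ∈ Set.Icc (0 : ℝ) 1 :=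
  ⟨by linarith [h.1.1], by linarith [h.1.2]⟩

/-- The product of the Bernoulli measures with parameters `(1 + m 0) / 2` and `m 1`. -/
def initialMeasure (m : Fin 2 → ℝ) (h : IsMacrostate m) : Measure State :=
  (siteBernoulli ⟨(1 + m 0) / 2, h.up_mem⟩).prod (siteBernoulli ⟨m 1, h.2⟩)

/-! ### Dynamics and macroscopic variables -/

/-- The Kac chain dynamics. For bits, `a + b - 2 * a * b` is the exclusive or. -/
def dyn (s : State) : State :=
  (fun i => xor (s.1 (i - 1)) (s.2 (i - 1)), s.2)

/-- The average magnetization and the fraction of scatterers over the `2 * N + 1` sites around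
the origin. -/
def macroVar (N : ℕ) (s : State) : Fin 2 → ℝ :=
  ![(1 / (2 * (N : ℝ) + 1)) * ∑ i ∈ Finset.Icc (-(N : ℤ)) N, (2 * ((s.1 i).toNat : ℝ) - 1),
    (1 / (2 * (N : ℝ) + 1)) * ∑ i ∈ Finset.Icc (-(N : ℤ)) N, ((s.2 i).toNat : ℝ)]

/-- The macroscopic law. -/
def macroLaw (m : Fin 2 → ℝ) : Fin 2 → ℝ :=
  ![(1 - 2 * m 1) * m 0, m 1]

end KacChain

end

namespace KacChain

/-! In spin variables exclusive or is multiplication, so the spin at site `i` and time `t` is the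
initial spin at `i - t` times the factors `1 - 2y` of the `t` scatterers it has crossed
(`spin_dyn_iterate`). Such a monomial is a `character`. Independence makes its mean the product of
the means of its factors, here `(1 - 2 * m 1) ^ t * m 0`, which is the macroscopic law iterated `t`
times. Characters with disjoint supports are uncorrelated, and for range at most `t` each site
interacts with at most `2 * t + 1` others. So the variance of a sum grows linearly in the number of
sites, and Chebyshev's inequality bounds the probability of a deviation of the frequency by
`O(1/M)`. Along the squares `M = k ^ 2` these bounds are summable, with an explicit tail. A
deviation is decided by a finite prefix of the code and a comparison of integers, so the tails form
a Martin-Löf test (`isMLTest_deviates`), which a random microstate escapes. Counts of ones are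
monotone, so convergence along the squares gives convergence (`tendsto_frequency_of_isMLRandom`). -/

/-! ### Characters: means, covariances and Chebyshev's inequality. -/

/-- The spin `1` or `-1` of a bit. -/
def spin (b : Bool) : ℝ := 2 * (b.toNat : ℝ) - 1

/-- The product of the spins at the sites of `A` and of the opposite scatterer signs at the sites
of `B`. -/
def character (A B : Finset ℤ) (s : State) : ℝ :=
  (∏ a ∈ A, spin (s.1 a)) * ∏ b ∈ B, -spin (s.2 b)

theorem abs_spin (b : Bool) : |spin b| = 1 := by
  cases b <;> norm_num [spin]

theorem abs_character (A B : Finset ℤ) (s : State) : |character A B s| = 1 := by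
  simp [character, abs_mul, Finset.abs_prod, abs_spin]

theorem measurable_character (A B : Finset ℤ) : Measurable (character A B) := by
  have h : Measurable spin := measurable_of_finite _
  unfold character
  refine Measurable.mul ?_ ?_
  · exact Finset.measurable_prod _ fun a _ =>
      h.comp ((measurable_pi_apply a).comp measurable_fst)
  · exact Finset.measurable_prod _ fun a _ =>
      (h.comp ((measurable_pi_apply a).comp measurable_snd)).neg

theorem character_mul {A B A' B' : Finset ℤ} (hA : Disjoint A A') (hB : Disjoint B B')
    (s : State) :
    character A B s * character A' B' s = character (A ∪ A') (B ∪ B') s := by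
  simp only [character, Finset.prod_union hA, Finset.prod_union hB]
  ring

instance (p : unitInterval) : IsProbabilityMeasure (siteBernoulli p) := by
  unfold siteBernoulli
  infer_instance

instance (m : Fin 2 → ℝ) (h : IsMacrostate m) : IsProbabilityMeasure (initialMeasure m h) := by
  unfold initialMeasure
  infer_instance

theorem integral_prod_siteBernoulli (p : unitInterval) (A : Finset ℤ) (f : Bool → ℝ) :
    ∫ x, ∏ a ∈ A, f (x a) ∂siteBernoulli p
      = (∫ b, f b ∂(bernoulliMeasure true false p)) ^ A.card := by
  have h := integral_restrict_infinitePi (μ := fun _ : ℤ => bernoulliMeasure true false p)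
    (s := A) (f := fun v => ∏ a, f (v a))
    ((Finset.measurable_prod _ fun a _ =>
      (measurable_of_finite f).comp (measurable_pi_apply a)).aestronglyMeasurable)
  have h2 := integral_fintype_prod_eq_pow (ι := A) (μ := bernoulliMeasure true false p) f
  rw [Fintype.card_coe] at h2
  rw [← h2, ← h, siteBernoulli]
  refine integral_congr_ae (.of_forall fun x => ?_)
  simp only [Finset.restrict]
  exact (Finset.prod_coe_sort A fun a => f (x a)).symm

theorem integral_character (m : Fin 2 → ℝ) (h : IsMacrostate m) (A B : Finset ℤ) :
    ∫ s, character A B s ∂initialMeasure m h = m 0 ^ A.card * (1 - 2 * m 1) ^ B.card := by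
  unfold character initialMeasure
  rw [integral_prod_mul (f := fun x : ℤ → Bool => ∏ a ∈ A, spin (x a))
    (g := fun y : ℤ → Bool => ∏ b ∈ B, -spin (y b)), integral_prod_siteBernoulli,
    integral_prod_siteBernoulli (f := fun b => -spin b)]
  congr 2
  · simp [integral_bernoulliMeasure, spin]
    ring
  · simp [integral_bernoulliMeasure, spin]
    ring

/-- The product of two characters with disjoint supports is again a character, and means of
characters are multiplicative in the supports, so the covariance vanishes. -/
theorem integral_centered_mul (m : Fin 2 → ℝ) (h : IsMacrostate m) {A B A' B' : Finset ℤ}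
    (hA : Disjoint A A') (hB : Disjoint B B') {L : ℝ}
    (hL : m 0 ^ A.card * (1 - 2 * m 1) ^ B.card = L)
    (hL' : m 0 ^ A'.card * (1 - 2 * m 1) ^ B'.card = L) :
    ∫ s, (character A B s - L) * (character A' B' s - L) ∂initialMeasure m h = 0 := by
  have hi : ∀ A B, Integrable (character A B) (initialMeasure m h) := fun A B =>
    .of_bound (measurable_character A B).aestronglyMeasurable 1
      (.of_forall fun s => (abs_character A B s).le)
  have hrw : ∀ s, (character A B s - L) * (character A' B' s - L) =
      character (A ∪ A') (B ∪ B') s - L * character A B s - L * character A' B' s + L * L := by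
    intro s
    rw [← character_mul hA hB]
    ring
  simp_rw [hrw]
  have hu : Integrable (fun s => L * character A B s) (initialMeasure m h) := (hi A B).const_mul L
  have hv : Integrable (fun s => L * character A' B' s) (initialMeasure m h) :=
    (hi A' B').const_mul L
  have huv : Integrable (fun s => character (A ∪ A') (B ∪ B') s - L * character A B s)
    (initialMeasure m h) := (hi _ _).sub hu
  have huvw : Integrable (fun s => character (A ∪ A') (B ∪ B') s - L * character A B s -
    L * character A' B' s) (initialMeasure m h) := huv.sub hv
  rw [integral_add huvw (integrable_const _), integral_sub huv hv,
    integral_sub (hi _ _) hu, integral_const_mul,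
    integral_const_mul, integral_character, integral_character, integral_character, hL, hL',
    Finset.card_union_of_disjoint hA, Finset.card_union_of_disjoint hB, pow_add, pow_add]
  simp only [integral_const, probReal_univ, smul_eq_mul]
  linear_combination L * hL + m 0 ^ A.card * (1 - 2 * m 1) ^ B.card * hL'

/-- The second moment of a sum of centered characters of range at most `t`. -/
theorem integral_sq_sum_character_le (m : Fin 2 → ℝ) (h : IsMacrostate m) (A B : ℤ → Finset ℤ)
    (t : ℕ) (hA : ∀ i, A i ⊆ Finset.Icc (i - t) i) (hB : ∀ i, B i ⊆ Finset.Icc (i - t) i)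
    {L : ℝ} (hL : ∀ i, m 0 ^ (A i).card * (1 - 2 * m 1) ^ (B i).card = L) (hL1 : |L| ≤ 1)
    (I : Finset ℤ) :
    ∫ s, (∑ i ∈ I, (character (A i) (B i) s - L)) ^ 2 ∂initialMeasure m h
      ≤ 4 * (2 * t + 1) * I.card := by
  have hm : ∀ i j, Measurable fun s =>
      (character (A i) (B i) s - L) * (character (A j) (B j) s - L) := fun i j =>
    ((measurable_character _ _).sub_const _).mul ((measurable_character _ _).sub_const _)
  have hb1 : ∀ i s, |character (A i) (B i) s - L| ≤ 2 := fun i s =>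
    (abs_sub _ _).trans (by rw [abs_character]; linarith)
  have hb : ∀ i j s, |(character (A i) (B i) s - L) * (character (A j) (B j) s - L)| ≤ 4 := by
    intro i j s
    rw [abs_mul]
    calc _ ≤ (2 : ℝ) * 2 := mul_le_mul (hb1 i s) (hb1 j s) (abs_nonneg _) (by norm_num)
      _ = 4 := by norm_num
  have hi : ∀ i j, Integrable (fun s =>
      (character (A i) (B i) s - L) * (character (A j) (B j) s - L)) (initialMeasure m h) :=
    fun i j => .of_bound (hm i j).aestronglyMeasurable 4 (.of_forall fun s => hb i j s)
  simp_rw [sq, Finset.sum_mul_sum]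
  rw [integral_finsetSum _ fun i _ => integrable_finsetSum _ fun j _ => hi i j]
  simp_rw [fun i => integral_finsetSum I (fun j _ => hi i j)]
  -- Only indices within distance `t` can have overlapping supports; they alone contribute, at most
  -- 4 each.
  have hdisj : ∀ {i j : ℤ} {U V : Finset ℤ}, U ⊆ Finset.Icc (i - t) i → V ⊆ Finset.Icc (j - t) j →
      j ∉ Finset.Icc (i - t) (i + t) → Disjoint U V := by
    intro i j U V hU hV hij
    rw [Finset.disjoint_left]
    intro a ha hb
    have h1 := Finset.mem_Icc.1 (hU ha)
    have h2 := Finset.mem_Icc.1 (hV hb)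
    exact hij (Finset.mem_Icc.2 ⟨by omega, by omega⟩)
  have key : ∀ i ∈ I, ∑ j ∈ I, ∫ s, (character (A i) (B i) s - L) *
      (character (A j) (B j) s - L) ∂initialMeasure m h ≤ 4 * (2 * t + 1) := by
    intro i _
    calc _ ≤ ∑ j ∈ I, if j ∈ Finset.Icc (i - t) (i + t) then (4 : ℝ) else 0 := by
          refine Finset.sum_le_sum fun j _ => ?_
          split_ifs with hij
          · refine (integral_mono (hi i j) (integrable_const 4)
              fun s => (le_abs_self _).trans (hb i j s)).trans ?_
            simp
          · exact (integral_centered_mul m h (hdisj (hA i) (hA j) hij) (hdisj (hB i) (hB j) hij)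
              (hL i) (hL j)).le
      _ = 4 * ((I.filter (· ∈ Finset.Icc (i - t) (i + t))).card : ℝ) := by
          rw [← Finset.sum_filter, Finset.sum_const, nsmul_eq_mul, mul_comm]
      _ ≤ 4 * ((Finset.Icc (i - (t : ℤ)) (i + t)).card : ℝ) := by
          gcongr
          intro j hj
          exact (Finset.mem_filter.1 hj).2
      _ = 4 * (2 * t + 1) := by
          rw [Int.card_Icc, show i + t + 1 - (i - t) = ((2 * t + 1 : ℕ) : ℤ) by push_cast; ring,
            Int.toNat_natCast]
          push_cast
          ring
  calc _ ≤ ∑ i ∈ I, (4 * (2 * (t : ℝ) + 1)) := Finset.sum_le_sum key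
    _ = _ := by rw [Finset.sum_const, nsmul_eq_mul, mul_comm]

/-- Chebyshev's inequality for sums of characters of range at most `t`. -/
theorem measure_sum_character_le (m : Fin 2 → ℝ) (h : IsMacrostate m) (A B : ℤ → Finset ℤ)
    (t : ℕ) (hA : ∀ i, A i ⊆ Finset.Icc (i - t) i) (hB : ∀ i, B i ⊆ Finset.Icc (i - t) i)
    {L : ℝ} (hL : ∀ i, m 0 ^ (A i).card * (1 - 2 * m 1) ^ (B i).card = L) (hL1 : |L| ≤ 1)
    (I : Finset ℤ) {r : ℝ} (hr : 0 < r) :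
    initialMeasure m h {s | r ≤ |∑ i ∈ I, (character (A i) (B i) s - L)|}
      ≤ ENNReal.ofReal (4 * (2 * t + 1) * I.card / r ^ 2) := by
  have hm : Measurable fun s => ∑ i ∈ I, (character (A i) (B i) s - L) :=
    Finset.measurable_sum _ fun i _ => (measurable_character _ _).sub_const _
  have hb : ∀ s, |∑ i ∈ I, (character (A i) (B i) s - L)| ≤ ∑ i ∈ I, (2 : ℝ) := fun s =>
    (Finset.abs_sum_le_sum_abs _ _).trans (Finset.sum_le_sum fun i _ =>
      (abs_sub _ _).trans (by rw [abs_character]; linarith))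
  have hi : Integrable (fun s => (∑ i ∈ I, (character (A i) (B i) s - L)) ^ 2)
      (initialMeasure m h) :=
    .of_bound (hm.pow_const 2).aestronglyMeasurable ((∑ i ∈ I, (2 : ℝ)) ^ 2)
      (.of_forall fun s => by
        rw [Real.norm_eq_abs, abs_pow]
        exact pow_le_pow_left₀ (abs_nonneg _) (hb s) 2)
  have h1 := mul_meas_ge_le_integral_of_nonneg (.of_forall fun s => sq_nonneg _) hi (r ^ 2)
  have hset : {s | r ^ 2 ≤ (∑ i ∈ I, (character (A i) (B i) s - L)) ^ 2} =
      {s | r ≤ |∑ i ∈ I, (character (A i) (B i) s - L)|} := by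
    ext s
    simp only [Set.mem_ofPred_eq]
    rw [sq_le_sq, abs_of_pos hr]
  rw [hset] at h1
  rw [← ofReal_measureReal]
  refine ENNReal.ofReal_le_ofReal ?_
  rw [le_div_iff₀ (by positivity), mul_comm]
  exact h1.trans (integral_sq_sum_character_le m h A B t hA hB hL hL1 I)

/-! ### An effective law of large numbers. -/

/-- The number of ones among the first `M` values of `f`. -/
def ones (f : ℕ → Bool) (M : ℕ) : ℕ := ∑ n ∈ Finset.range M, (f n).toNat

theorem monotone_ones (f : ℕ → Bool) : Monotone (ones f) := fun _ _ h =>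
  Finset.sum_le_sum_of_subset (Finset.range_mono h)

theorem primrec_ones {α : Type*} [Primcodable α] {X : α → ℕ → Bool} (hX : Primrec₂ X) :
    Primrec₂ fun a M => ones (X a) M := by
  have h : Primrec₂ fun (a : α) (M : ℕ) =>
      (M.rec 0 fun n c => c + (X a n).toNat : ℕ) := by
    refine Primrec.nat_rec (f := fun _ : α => 0)
      (g := fun a q => q.2 + (X a q.1).toNat) (Primrec.const 0) ?_
    refine Primrec.nat_add.comp (Primrec.snd.comp Primrec.snd) ?_
    exact (Primrec.dom_bool Bool.toNat).comp
      (hX.comp Primrec.fst (Primrec.fst.comp Primrec.snd))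
  refine h.of_eq fun a M => ?_
  induction M with
  | zero => rfl
  | succ n ih => rw [ones, Finset.sum_range_succ, ← ones, ← ih]

/-- The enumerating function returns its input string if the predicate holds and is undefined
otherwise. -/
theorem uniformlyCE_of_primrecPred {D : List Bool × ℕ → Prop} (hD : PrimrecPred D) :
    UniformlyCE fun n => {σ | D (σ, n)} := by
  classical
  refine ⟨fun a => ((if D a then some a.1 else none : Option (List Bool)) : Part (List Bool)),
    Computable.ofOption (Primrec.to_comp (Primrec.ite hD (Primrec.option_some.comp Primrec.fst)
      (Primrec.const none))), fun n => ?_⟩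
  ext τ
  simp only [Set.mem_ofPred_eq, Part.mem_coe]
  constructor
  · intro h
    exact ⟨τ, by simp [h]⟩
  · rintro ⟨σ, hσ⟩
    split_ifs at hσ with h
    · simp only [Option.mem_def, Option.some.injEq] at hσ
      exact hσ ▸ h
    · simp at hσ

/-- The frequency `c / M` differs from `a / d` by more than `2 / d`. -/
def Deviates (a d M c : ℕ) : Prop := d * c + 2 * M < a * M ∨ a * M + 2 * M < d * c

/-- As `a / d` is within `1 / d` of `p`, the margin `2 / d` leaves a true deviation of at least `1 /
d`; without deviation, the frequency is within `3 / d` of `p`. -/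
theorem Deviates.le_abs {a d M c : ℕ} {p : ℝ} (hd : 0 < d) (hp : |p * d - a| ≤ 1)
    (h : Deviates a d M c) : 1 / (d : ℝ) * M ≤ |(c : ℝ) - p * M| := by
  have hd' : (0 : ℝ) < d := by exact_mod_cast hd
  have habs : |(c : ℝ) - p * M| * d = |(c - p * M) * d| := by rw [abs_mul, abs_of_pos hd']
  rw [one_div_mul_eq_div, div_le_iff₀ hd', habs]
  obtain ⟨h1, h2⟩ := abs_le.1 hp
  have hM : (0 : ℝ) ≤ M := Nat.cast_nonneg M
  rcases h with h | h
  · have h' : (d : ℝ) * c + 2 * M < a * M := by exact_mod_cast h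
    rw [abs_of_nonpos] <;> nlinarith
  · have h' : (a : ℝ) * M + 2 * M < d * c := by exact_mod_cast h
    rw [abs_of_nonneg] <;> nlinarith

theorem abs_le_of_not_deviates {a d M c : ℕ} {p : ℝ} (hd : 0 < d) (hp : |p * d - a| ≤ 1)
    (h : ¬ Deviates a d M c) (hM : 0 < M) : |(c : ℝ) / M - p| ≤ 3 / d := by
  have hd' : (0 : ℝ) < d := by exact_mod_cast hd
  have hM' : (0 : ℝ) < M := by exact_mod_cast hM
  obtain ⟨h1, h2⟩ := abs_le.1 hp
  simp only [Deviates, not_or, not_lt] at h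
  have h3 : (a : ℝ) * M ≤ d * c + 2 * M := by exact_mod_cast h.1
  have h4 : (d : ℝ) * c ≤ a * M + 2 * M := by exact_mod_cast h.2
  have : (c : ℝ) / M - p = (c - p * M) / M := by field_simp
  have habs : |(c : ℝ) - p * M| * d = |(c - p * M) * d| := by rw [abs_mul, abs_of_pos hd']
  rw [this, abs_div, abs_of_pos hM', div_le_div_iff₀ hM' hd', habs, abs_le]
  constructor <;> nlinarith

/-- Telescoping of `1 / (n + 1) ^ 2 ≤ 1 / n - 1 / (n + 1)`. -/
theorem sum_inv_sq_shift_le (K : ℕ) (hK : 0 < K) (J : ℕ) :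
    ∑ j ∈ Finset.range J, 1 / (((K + 1 + j : ℕ) : ℝ) ^ 2) ≤ 1 / K - 1 / ((K + J : ℕ) : ℝ) := by
  have hK' : (0 : ℝ) < K := by exact_mod_cast hK
  induction J with
  | zero => simp
  | succ J ih =>
    rw [Finset.sum_range_succ]
    have : 1 / (((K + 1 + J : ℕ) : ℝ) ^ 2) ≤
        1 / ((K + J : ℕ) : ℝ) - 1 / ((K + (J + 1) : ℕ) : ℝ) := by
      push_cast
      have hJ : (0 : ℝ) ≤ J := Nat.cast_nonneg J
      rw [div_sub_div _ _ (by positivity) (by positivity),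
        div_le_div_iff₀ (by positivity) (by positivity)]
      nlinarith
    linarith

/-- If the `k`-th event has measure at most `C / k ^ 2`, then the union of the events beyond `c * 2 ^ n`
has measure at most `2⁻¹ ^ n`. -/
theorem measure_iUnion_le_of_le_div_sq {Ω : Type*} [MeasurableSpace Ω] (ν : Measure Ω)
    (E : ℕ → Set Ω) {C : ℝ} {c : ℕ} (hc : 0 < c) (hCc : C ≤ c)
    (hE : ∀ k, 0 < k → ν (E k) ≤ ENNReal.ofReal (C / (k : ℝ) ^ 2)) (n : ℕ) :
    ν (⋃ k ∈ {k | c * 2 ^ n < k}, E k) ≤ (2 : ℝ≥0∞)⁻¹ ^ n := by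
  have hK : 0 < c * 2 ^ n := by positivity
  set K := c * 2 ^ n with hKdef
  have hsub : (⋃ k ∈ {k | K < k}, E k) ⊆ ⋃ j, E (K + 1 + j) := by
    intro z hz
    simp only [Set.mem_iUnion, Set.mem_ofPred_eq, exists_prop] at hz ⊢
    obtain ⟨k, hk, hz⟩ := hz
    exact ⟨k - (K + 1), by rwa [show K + 1 + (k - (K + 1)) = k by omega]⟩
  refine (measure_mono hsub).trans ((measure_iUnion_le _).trans ?_)
  refine ENNReal.tsum_le_of_sum_range_le fun J => ?_
  have hpos : (0 : ℝ) < c := by exact_mod_cast hc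
  calc ∑ j ∈ Finset.range J, ν (E (K + 1 + j))
      ≤ ∑ j ∈ Finset.range J, ENNReal.ofReal (c * (1 / (((K + 1 + j : ℕ) : ℝ) ^ 2))) := by
        refine Finset.sum_le_sum fun j _ => (hE _ (by omega)).trans (ENNReal.ofReal_le_ofReal ?_)
        rw [mul_one_div]
        gcongr
    _ = ENNReal.ofReal (∑ j ∈ Finset.range J, c * (1 / (((K + 1 + j : ℕ) : ℝ) ^ 2))) :=
        (ENNReal.ofReal_sum_of_nonneg fun j _ => by positivity).symm
    _ ≤ ENNReal.ofReal ((2 : ℝ)⁻¹ ^ n) := by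
        refine ENNReal.ofReal_le_ofReal ?_
        rw [← Finset.mul_sum]
        calc _ ≤ (c : ℝ) * (1 / K) := by
              gcongr
              exact (sum_inv_sq_shift_le K hK J).trans (sub_le_self _ (by positivity))
          _ = (2 : ℝ)⁻¹ ^ n := by
              rw [hKdef]
              push_cast
              rw [inv_pow]
              field_simp
    _ = (2 : ℝ≥0∞)⁻¹ ^ n := by
        rw [ENNReal.ofReal_pow (by positivity), ENNReal.ofReal_inv_of_pos (by norm_num)]
        simp

/-- `X` computes the bits `x z n` from prefixes of `z` of length at least `2 * n + c`. -/
def ComputesFromPrefix (X : List Bool → ℕ → Bool) (x : (ℕ → Bool) → ℕ → Bool) (c : ℕ) : Prop :=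
  ∀ σ z, z ∈ cylinder σ → ∀ n, 2 * n + c ≤ σ.length → X σ n = x z n

theorem mem_cylinder_ofFn (z : ℕ → Bool) (l : ℕ) :
    z ∈ cylinder (List.ofFn fun i : Fin l => z i) := by
  intro i h
  simp

theorem primrecPred_deviates {α : Type*} [Primcodable α] (a d : ℕ) {M c : α → ℕ} (hM : Primrec M)
    (hc : Primrec c) : PrimrecPred fun x => Deviates a d (M x) (c x) := by
  have h1 : ∀ (e : ℕ) {f : α → ℕ}, Primrec f → Primrec fun x => e * f x := fun e f hf =>
    Primrec.nat_mul.comp (Primrec.const e) hf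
  exact PrimrecPred.or
    (Primrec.nat_lt.comp (Primrec.nat_add.comp (h1 d hc) (h1 2 hM)) (h1 a hM))
    (Primrec.nat_lt.comp (Primrec.nat_add.comp (h1 a hM) (h1 2 hM)) (h1 d hc))

/-- The deviations of the frequencies along the squares form a Martin-Löf test. -/
theorem isMLTest_deviates (ν : Measure (ℕ → Bool)) {X : List Bool → ℕ → Bool}
    (hX : Primrec₂ X) {x : (ℕ → Bool) → ℕ → Bool} {l : ℕ} (hXx : ComputesFromPrefix X x l)
    (a d : ℕ) {C : ℝ} {c : ℕ} (hc : 0 < c) (hCc : C ≤ c)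
    (hE : ∀ k, 0 < k → ν {z | Deviates a d (k * k) (ones (x z) (k * k))}
      ≤ ENNReal.ofReal (C / (k : ℝ) ^ 2)) :
    IsMLTest ν fun n => ⋃ k ∈ {k | c * 2 ^ n < k},
      {z | Deviates a d (k * k) (ones (x z) (k * k))} := by
  have hones : ∀ σ z, z ∈ cylinder σ → ∀ M, 2 * M + l ≤ σ.length →
      ones (X σ) M = ones (x z) M := fun σ z hz M hM =>
    Finset.sum_congr rfl fun n hn => by
      rw [hXx σ z hz n (by have := Finset.mem_range.1 hn; omega)]
  refine ⟨?_, measure_iUnion_le_of_le_div_sq ν _ hc hCc hE⟩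
  -- The length of a string encodes which `k` it witnesses, so membership is decided without a
  -- search.
  let k : List Bool → ℕ := fun σ => σ.length.unpair.1
  let D : List Bool × ℕ → Prop := fun q => c * 2 ^ q.2 < k q.1 ∧
    2 * (k q.1 * k q.1) + l ≤ q.1.length ∧
    Deviates a d (k q.1 * k q.1) (ones (X q.1) (k q.1 * k q.1))
  have hk : Primrec fun q : List Bool × ℕ => k q.1 :=
    Primrec.fst.comp (Primrec.unpair.comp (Primrec.list_length.comp Primrec.fst))
  have hkk : Primrec fun q : List Bool × ℕ => k q.1 * k q.1 := Primrec.nat_mul.comp hk hk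
  have hpow : Primrec fun n : ℕ => 2 ^ n :=
    ((Primrec.nat_rec₁ 1 (f := fun _ b => 2 * b)
      (Primrec.nat_mul.comp (Primrec.const 2) Primrec.snd)).of_eq fun n => by
        induction n with
        | zero => rfl
        | succ n ih => rw [pow_succ, ← ih, mul_comm])
  have hD : PrimrecPred D := by
    refine PrimrecPred.and ?_ (PrimrecPred.and ?_ ?_)
    · exact Primrec.nat_lt.comp (Primrec.nat_mul.comp (Primrec.const c) (hpow.comp Primrec.snd)) hk
    · exact Primrec.nat_le.comp (Primrec.nat_add.comp (Primrec.nat_mul.comp (Primrec.const 2) hkk)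
        (Primrec.const l)) (Primrec.list_length.comp Primrec.fst)
    · exact primrecPred_deviates a d hkk ((primrec_ones hX).comp Primrec.fst hkk)
  refine ⟨fun n => {σ | D (σ, n)}, uniformlyCE_of_primrecPred hD, fun n => ?_⟩
  ext z
  simp only [Set.mem_iUnion, Set.mem_ofPred_eq, exists_prop]
  constructor
  · rintro ⟨j, hj, hz⟩
    -- The second component of the pair forces the prefix to be long enough to determine the first
    -- `j * j` bits.
    let σ := List.ofFn fun i : Fin (Nat.pair j (2 * (j * j) + l)) => z i
    have hz' : z ∈ cylinder σ := mem_cylinder_ofFn z _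
    have hlen : σ.length = Nat.pair j (2 * (j * j) + l) := List.length_ofFn
    have hkσ : k σ = j := by simp only [k, hlen, Nat.unpair_pair]
    have hle : 2 * (j * j) + l ≤ σ.length := hlen ▸ Nat.right_le_pair _ _
    refine ⟨σ, ⟨?_, ?_, ?_⟩, hz'⟩
    · simpa only [hkσ] using hj
    · simpa only [hkσ] using hle
    · simpa only [hkσ, hones σ z hz' _ hle] using hz
  · rintro ⟨σ, ⟨h1, h2, h3⟩, hz⟩
    exact ⟨k σ, h1, by simpa only [hones σ z hz _ h2] using h3⟩

/-- A law of large numbers for Martin-Löf random sequences: if the frequency of ones in a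
sequence of uniformly computable local observables satisfies a Chebyshev bound around `p`, then it
converges to `p` along every random sequence. -/
theorem tendsto_frequency_of_isMLRandom (ν : Measure (ℕ → Bool)) {X : List Bool → ℕ → Bool}
    (hX : Primrec₂ X) {x : (ℕ → Bool) → ℕ → Bool} {l : ℕ} (hXx : ComputesFromPrefix X x l)
    {p C : ℝ} (hp : 0 ≤ p)
    (hC : ∀ M : ℕ, 0 < M → ∀ δ : ℝ, 0 < δ → ν {z | δ * M ≤ |(ones (x z) M : ℝ) - p * M|}
      ≤ ENNReal.ofReal (C / (δ ^ 2 * M)))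
    {z : ℕ → Bool} (hz : IsMLRandom ν z) :
    Tendsto (fun M : ℕ => (ones (x z) M : ℝ) / M) atTop (𝓝 p) := by
  refine tendsto_div_of_monotone_of_exists_subseq_tendsto_div _ p
    (fun a b h => Nat.cast_le.2 (monotone_ones (x z) h)) fun b hb => ?_
  -- Consecutive squares have ratio tending to 1, so a monotone count is controlled between them.
  refine ⟨fun k => k * k, ?_, tendsto_id.atTop_mul_atTop₀ tendsto_id, ?_⟩
  · have h1 : Tendsto (fun n : ℕ => (1 + 1 / (n : ℝ)) ^ 2) atTop (𝓝 ((1 + 0) ^ 2)) :=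
      (tendsto_const_nhds.add tendsto_one_div_atTop_nhds_zero_nat).pow 2
    have h2 := h1.eventually (gt_mem_nhds (show ((1 : ℝ) + 0) ^ 2 < b by simpa using hb))
    filter_upwards [h2, eventually_gt_atTop 0] with n hn hn0
    have : (0 : ℝ) < n := by exact_mod_cast hn0
    push_cast
    calc ((n : ℝ) + 1) * (n + 1) = (1 + 1 / (n : ℝ)) ^ 2 * (n * n) := by field_simp
      _ ≤ b * (n * n) := by gcongr
  · rw [Metric.tendsto_atTop]
    intro ε hε
    obtain ⟨d, hd⟩ := exists_nat_gt (3 / ε)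
    have hd0 : (0 : ℝ) < d := (by positivity : 0 < 3 / ε).trans hd
    have hdn : 0 < d := by exact_mod_cast hd0
    have ha : |p * d - (⌊p * d⌋₊ : ℕ)| ≤ 1 := by
      have h1 := Nat.floor_le (show 0 ≤ p * d by positivity)
      have h2 := Nat.lt_floor_add_one (p * d)
      rw [abs_le]
      constructor <;> linarith
    -- With `δ = 1 / d` and `M = k * k` the Chebyshev bound is `C * d ^ 2 / k ^ 2`.
    obtain ⟨c, hc⟩ := exists_nat_gt (max (C * d ^ 2) 0)
    have hc0 : 0 < c := by exact_mod_cast (le_max_right _ _).trans_lt hc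
    have htest := isMLTest_deviates ν hX hXx ⌊p * d⌋₊ d hc0 ((le_max_left _ _).trans hc.le)
      fun k hk => (measure_mono fun w (hw : Deviates _ _ _ _) => hw.le_abs hdn ha).trans <|
        (hC (k * k) (by positivity) (1 / d) (by positivity)).trans <|
          ENNReal.ofReal_le_ofReal <| le_of_eq <| by
            have : (k : ℝ) ≠ 0 := by positivity
            push_cast
            field_simp
    have hnot : ¬ ({z} : Set (ℕ → Bool)) ⊆ ⋂ n, ⋃ k ∈ {k | c * 2 ^ n < k},
        {z | Deviates ⌊p * d⌋₊ d (k * k) (ones (x z) (k * k))} :=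
      fun hsub => hz ⟨_, htest, hsub⟩
    simp only [Set.singleton_subset_iff, Set.mem_iInter, not_forall, Set.mem_iUnion,
      Set.mem_ofPred_eq, exists_prop, not_exists, not_and] at hnot
    obtain ⟨n, hn⟩ := hnot
    refine ⟨c * 2 ^ n + 1, fun k hk => ?_⟩
    rw [Real.dist_eq]
    refine (abs_le_of_not_deviates hdn ha (hn k (by omega))
      (Nat.mul_pos (by omega) (by omega))).trans_lt ?_
    rw [div_lt_iff₀ hε] at hd
    rw [div_lt_iff₀ hd0]
    linarith

/-! ### From sequences of bits to averages over the lattice. -/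

theorem site_injective : Function.Injective site := by
  intro a b h
  simp only [site] at h
  split_ifs at h <;> omega

theorem map_site_range (N : ℕ) :
    (Finset.range (2 * N + 1)).map ⟨site, site_injective⟩ = Finset.Icc (-(N : ℤ)) N := by
  refine Finset.eq_of_subset_of_card_le (fun i hi => ?_) ?_
  · obtain ⟨n, hn, rfl⟩ := Finset.mem_map.1 hi
    have := Finset.mem_range.1 hn
    simp only [Function.Embedding.coeFn_mk, Finset.mem_Icc, site]
    split_ifs <;> omega
  · rw [Finset.card_map, Finset.card_range, Int.card_Icc]
    omega

/-- Convergence of averages along a random microstate, for a field of bits whose spins are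
characters of range at most `t`, up to a sign `κ`. -/
theorem tendsto_average_of_isMLRandomState (m : Fin 2 → ℝ) (h : IsMacrostate m)
    (A B : ℤ → Finset ℤ) (t : ℕ) (hA : ∀ i, A i ⊆ Finset.Icc (i - t) i)
    (hB : ∀ i, B i ⊆ Finset.Icc (i - t) i)
    {L : ℝ} (hL : ∀ i, m 0 ^ (A i).card * (1 - 2 * m 1) ^ (B i).card = L)
    {κ : ℝ} (hκ : |κ| = 1) {b : State → ℤ → Bool}
    (hb : ∀ s i, spin (b s i) = κ * character (A i) (B i) s)
    {X : List Bool → ℕ → Bool} (hX : Primrec₂ X) {x : (ℕ → Bool) → ℕ → Bool} {l : ℕ}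
    (hXx : ComputesFromPrefix X x l) (hx : ∀ n, Measurable fun z => x z n)
    (hxb : ∀ s n, x (encode s) n = b s (site n))
    {s : State} (hs : IsMLRandomState (initialMeasure m h) s) :
    Tendsto (fun N : ℕ => (1 / (2 * (N : ℝ) + 1)) *
      ∑ i ∈ Finset.Icc (-(N : ℤ)) N, ((b s i).toNat : ℝ)) atTop (𝓝 ((1 + κ * L) / 2)) := by
  have hL1 : |L| ≤ 1 := by
    rw [← hL 0, abs_mul, abs_pow, abs_pow]
    refine mul_le_one₀ (pow_le_one₀ (abs_nonneg _) (abs_le.2 h.1)) (by positivity)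
      (pow_le_one₀ (abs_nonneg _) (abs_le.2 ?_))
    exact ⟨by linarith [h.2.2], by linarith [h.2.1]⟩
  have hp : 0 ≤ (1 + κ * L) / 2 := by
    have : |κ * L| ≤ 1 := by rwa [abs_mul, hκ, one_mul]
    linarith [(abs_le.1 this).1]
  have hsum : ∀ (s : State) (M : ℕ), |(ones (x (encode s)) M : ℝ) - (1 + κ * L) / 2 * M| =
      |∑ i ∈ (Finset.range M).map ⟨site, site_injective⟩, (character (A i) (B i) s - L)| / 2 := by
    intro s M
    have : (ones (x (encode s)) M : ℝ) - (1 + κ * L) / 2 * M = κ / 2 *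
        ∑ i ∈ (Finset.range M).map ⟨site, site_injective⟩, (character (A i) (B i) s - L) := by
      rw [Finset.sum_map, Finset.mul_sum, ones]
      push_cast
      rw [show (1 + κ * L) / 2 * (M : ℝ) = ∑ n ∈ Finset.range M, (1 + κ * L) / 2 by
        rw [Finset.sum_const, Finset.card_range, nsmul_eq_mul, mul_comm], ← Finset.sum_sub_distrib]
      refine Finset.sum_congr rfl fun n _ => ?_
      have h1 := hb s (site n)
      rw [← hxb, spin] at h1
      simp only [Function.Embedding.coeFn_mk]
      linarith
    rw [this, abs_mul, abs_div, hκ, abs_of_pos (zero_lt_two' ℝ)]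
    ring
  have hones : ∀ M, Measurable fun z => (ones (x z) M : ℝ) := fun M => by
    unfold ones
    push_cast
    exact Finset.measurable_sum _ fun n _ =>
      (measurable_of_finite fun c : Bool => (c.toNat : ℝ)).comp (hx n)
  have hC : ∀ M : ℕ, 0 < M → ∀ δ : ℝ, 0 < δ → (initialMeasure m h).map encode
      {z | δ * M ≤ |(ones (x z) M : ℝ) - (1 + κ * L) / 2 * M|}
        ≤ ENNReal.ofReal ((2 * t + 1) / (δ ^ 2 * M)) := by
    intro M hM δ hδ
    have hM' : (0 : ℝ) < M := by exact_mod_cast hM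
    rw [Measure.map_apply measurable_encode
      (measurableSet_le measurable_const ((hones M).sub_const _).abs)]
    have hset : encode ⁻¹' {z | δ * M ≤ |(ones (x z) M : ℝ) - (1 + κ * L) / 2 * M|} =
        {s | 2 * (δ * M) ≤ |∑ i ∈ (Finset.range M).map ⟨site, site_injective⟩,
          (character (A i) (B i) s - L)|} := by
      ext s
      simp only [Set.mem_preimage, Set.mem_ofPred_eq]
      rw [hsum, le_div_iff₀ zero_lt_two, mul_comm]
    rw [hset]
    refine (measure_sum_character_le m h A B t hA hB hL hL1 _ (by positivity)).trans
      (ENNReal.ofReal_le_ofReal (le_of_eq ?_))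
    rw [Finset.card_map, Finset.card_range]
    field_simp
    ring
  have hlim := (tendsto_frequency_of_isMLRandom _ hX hXx hp hC hs).comp
    (tendsto_atTop_mono (f := fun N : ℕ => N) (g := fun N => 2 * N + 1) (fun N => by omega)
      tendsto_id)
  refine hlim.congr fun N => ?_
  rw [← map_site_range, Finset.sum_map]
  simp only [Function.comp_apply, Function.Embedding.coeFn_mk, ones, hxb]
  push_cast
  rw [div_eq_mul_inv, mul_comm, one_div]

/-- The index of the site to the left of the site with index `n`. -/
def predIndex (n : ℕ) : ℕ := if n % 2 = 1 then n + 2 else if n = 0 then 1 else n - 2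

theorem site_predIndex (n : ℕ) : site (predIndex n) = site n - 1 := by
  unfold predIndex
  split_ifs <;> simp only [site] <;> split_ifs <;> first | contradiction | omega

theorem predIndex_le (n : ℕ) : predIndex n ≤ n + 2 := by
  unfold predIndex
  split_ifs <;> omega

theorem primrec_predIndex : Primrec predIndex := by
  unfold predIndex
  refine Primrec.ite (Primrec.eq.comp (Primrec.nat_mod.comp Primrec.id (Primrec.const 2))
    (Primrec.const 1)) (Primrec.nat_add.comp Primrec.id (Primrec.const 2))
    (Primrec.ite (Primrec.eq.comp Primrec.id (Primrec.const 0)) (Primrec.const 1)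
      (Primrec.nat_sub.comp Primrec.id (Primrec.const 2)))

/-- The spin bit at time `t` at the site with index `n`, computed from the code `z` of the initial
microstate. -/
def chainBit (z : ℕ → Bool) : ℕ → ℕ → Bool
  | 0, n => z (2 * n)
  | t + 1, n => xor (chainBit z t (predIndex n)) (z (2 * predIndex n + 1))

theorem encode_two_mul (s : State) (n : ℕ) : encode s (2 * n) = s.1 (site n) := by
  simp [encode, kappa, iota]

theorem encode_two_mul_add_one (s : State) (n : ℕ) : encode s (2 * n + 1) = s.2 (site n) := by
  rw [encode, kappa, if_neg (by omega), iota, show (2 * n + 1) / 2 = n by omega]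

theorem dyn_iterate_snd (s : State) (t : ℕ) : (dyn^[t] s).2 = s.2 := by
  induction t with
  | zero => rfl
  | succ t ih => rw [Function.iterate_succ_apply', dyn, ih]

theorem dyn_iterate_succ_fst (s : State) (t : ℕ) (i : ℤ) :
    (dyn^[t + 1] s).1 i = xor ((dyn^[t] s).1 (i - 1)) (s.2 (i - 1)) := by
  rw [Function.iterate_succ_apply', dyn, dyn_iterate_snd]

theorem chainBit_encode (s : State) (t n : ℕ) :
    chainBit (encode s) t n = (dyn^[t] s).1 (site n) := by
  induction t generalizing n with
  | zero => exact encode_two_mul s n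
  | succ t ih =>
    rw [chainBit, ih, encode_two_mul_add_one, site_predIndex, dyn_iterate_succ_fst]

theorem measurable_chainBit (t n : ℕ) : Measurable fun z => chainBit z t n := by
  induction t generalizing n with
  | zero => exact measurable_pi_apply _
  | succ t ih =>
    exact (measurable_of_finite fun q : Bool × Bool => xor q.1 q.2).comp
      ((ih (predIndex n)).prodMk (measurable_pi_apply (2 * predIndex n + 1)))

/-- The sequence starting with `σ` and continuing with `false`. -/
def extendFalse (σ : List Bool) (j : ℕ) : Bool := σ.getD j false

theorem extendFalse_eq {σ : List Bool} {z : ℕ → Bool} (hz : z ∈ cylinder σ) {j : ℕ}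
    (hj : j < σ.length) : extendFalse σ j = z j := by
  rw [hz j hj, extendFalse, List.getD_eq_getElem]

theorem primrec_extendFalse : Primrec₂ extendFalse := Primrec.list_getD false

theorem primrec_chainBit (t : ℕ) : Primrec₂ fun σ n => chainBit (extendFalse σ) t n := by
  have h2 : ∀ {f : List Bool × ℕ → ℕ}, Primrec f → Primrec fun q => 2 * f q := fun hf =>
    Primrec.nat_mul.comp (Primrec.const 2) hf
  have hp : Primrec fun q : List Bool × ℕ => predIndex q.2 := primrec_predIndex.comp Primrec.snd
  induction t with
  | zero => exact primrec_extendFalse.comp Primrec.fst (h2 Primrec.snd)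
  | succ t ih =>
    exact (Primrec.dom_bool₂ xor).comp (ih.comp Primrec.fst hp)
      (primrec_extendFalse.comp Primrec.fst (Primrec.succ.comp (h2 hp)))

theorem computesFromPrefix_chainBit (t : ℕ) :
    ComputesFromPrefix (fun σ n => chainBit (extendFalse σ) t n) (fun z n => chainBit z t n)
      (4 * t + 2) := by
  intro σ z hz n hn
  induction t generalizing n with
  | zero => exact extendFalse_eq hz (by omega)
  | succ t ih =>
    have := predIndex_le n
    simp only [chainBit] at ih ⊢
    rw [ih _ (by omega), extendFalse_eq hz (by omega)]

theorem spin_xor (a b : Bool) : spin (xor a b) = spin a * -spin b := by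
  cases a <;> cases b <;> norm_num [spin]

theorem spin_dyn_iterate (s : State) (t : ℕ) (i : ℤ) :
    spin ((dyn^[t] s).1 i) = character {i - t} (Finset.Ico (i - t) i) s := by
  induction t generalizing i with
  | zero => simp [character]
  | succ t ih =>
    have h1 : i - ((t + 1 : ℕ) : ℤ) = i - 1 - t := by push_cast; ring
    have h2 : Finset.Ico (i - 1 - t) i = insert (i - 1) (Finset.Ico (i - 1 - t) (i - 1)) := by
      ext j
      simp only [Finset.mem_Ico, Finset.mem_insert]
      omega
    rw [dyn_iterate_succ_fst, spin_xor, ih, h1, h2, character, character,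
      Finset.prod_insert (by simp)]
    ring

theorem macroLaw_iterate (m : Fin 2 → ℝ) (t : ℕ) :
    macroLaw^[t] m = ![(1 - 2 * m 1) ^ t * m 0, m 1] := by
  induction t with
  | zero =>
    ext i
    fin_cases i <;> simp
  | succ t ih =>
    rw [Function.iterate_succ_apply', ih, macroLaw]
    ext i
    fin_cases i <;> simp [pow_succ']
    ring

theorem tendsto_magnetization (m : Fin 2 → ℝ) (h : IsMacrostate m) {s : State}
    (hs : IsMLRandomState (initialMeasure m h) s) (t : ℕ) :
    Tendsto (fun N : ℕ => macroVar N (dyn^[t] s) 0) atTop (𝓝 ((1 - 2 * m 1) ^ t * m 0)) := by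
  have h1 := tendsto_average_of_isMLRandomState m h (fun i => {i - t})
    (fun i => Finset.Ico (i - t) i) t (by simp) (fun i => Finset.Ico_subset_Icc_self)
    (L := (1 - 2 * m 1) ^ t * m 0)
    (fun i => by simp [mul_comm]) (κ := 1) (by simp) (b := fun s i => (dyn^[t] s).1 i)
    (fun s i => by rw [spin_dyn_iterate, one_mul]) (primrec_chainBit t)
    (computesFromPrefix_chainBit t) (measurable_chainBit t) (fun s n => chainBit_encode s t n) hs
  have h2 := (h1.const_mul 2).sub_const 1
  rw [show 2 * ((1 + 1 * ((1 - 2 * m 1) ^ t * m 0)) / 2) - 1 = (1 - 2 * m 1) ^ t * m 0 by ring]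
    at h2
  refine h2.congr fun N => ?_
  have hN : (0 : ℝ) < 2 * N + 1 := by positivity
  have hcard : ((Finset.Icc (-(N : ℤ)) N).card : ℝ) = 2 * N + 1 := by
    rw [← map_site_range, Finset.card_map, Finset.card_range]
    push_cast
    ring
  simp only [macroVar, Matrix.cons_val_zero]
  rw [Finset.sum_sub_distrib, ← Finset.mul_sum, Finset.sum_const, nsmul_eq_mul, hcard]
  field_simp

theorem tendsto_scatterers (m : Fin 2 → ℝ) (h : IsMacrostate m) {s : State}
    (hs : IsMLRandomState (initialMeasure m h) s) (t : ℕ) :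
    Tendsto (fun N : ℕ => macroVar N (dyn^[t] s) 1) atTop (𝓝 (m 1)) := by
  have h1 := tendsto_average_of_isMLRandomState m h (fun _ => ∅) (fun i => {i}) 0 (by simp)
    (by simp) (L := 1 - 2 * m 1) (by simp) (κ := -1) (by simp) (b := fun s i => s.2 i)
    (fun s i => by simp [character]) (X := fun σ n => extendFalse σ (2 * n + 1))
    (primrec_extendFalse.comp Primrec.fst
      (Primrec.succ.comp (Primrec.nat_mul.comp (Primrec.const 2) Primrec.snd)))
    (x := fun z n => z (2 * n + 1)) (l := 2)
    (fun σ z hz n hn => extendFalse_eq hz (by omega)) (fun n => measurable_pi_apply _)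
    (fun s n => encode_two_mul_add_one s n) hs
  rw [show (1 + -1 * (1 - 2 * m 1)) / 2 = m 1 by ring] at h1
  refine h1.congr fun N => ?_
  simp [macroVar, dyn_iterate_snd]

end KacChain

theorem theorem3 (m : Fin 2 → ℝ) (hm : KacChain.IsMacrostate m)
    (hcomp : ∀ i, KacChain.IsComputableReal (m i)) (T : ℕ) (s : KacChain.State)
    (hs : KacChain.IsMLRandomState (KacChain.initialMeasure m hm) s) :
    ∀ i : Fin 2, ∀ t : ℕ, t ≤ T →
      Tendsto (fun N : ℕ => KacChain.macroVar N (KacChain.dyn^[t] s) i) atTop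
        (𝓝 (KacChain.macroLaw^[t] m i)) := by
  intro i t _
  rw [KacChain.macroLaw_iterate]
  fin_cases i
  · exact KacChain.tendsto_magnetization m hm hs t
  · exact KacChain.tendsto_scatterers m hm hs t
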